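/- Let $\mathbf{k}$ be a subfield of $\mathbb{R}$, let $q\in\mathbf{k}$ with $q>0$, and let $n\ge 0$. Let $\mathcal{H}_n$ be the Hecke algebra over $\mathbf{k}$: the unital associative $\mathbf{k}$-algebra generated by $T_1,\dots,T_{n-1}$ subject to $T_i^2=(q-1)T_i+q$, $T_iT_j=T_jT_i$ for $|i-j|>1$, and $T_iT_{i+1}T_i=T_{i+1}T_iT_{i+1}$. Let $a\mapsto a^*$ be the algebra anti-automorphism of $\mathcal{H}_n$ fixing every $T_i$. For $m\le n$ put $\mathcal{B}_m=\sum_{i=1}^m T_{m-1}T_{m-2}\cdots T_i$ (so $\mathcal{B}_m=0$ for $m\le 0$), and for $k\ge 0$ put $$\mathcal{B}_{n,k}=\mathcal{B}_{n-(k-1)}\cdots\mathcal{B}_{n-1}\mathcal{B}_n,\qquad \mathcal{B}^*_{n,k}=(\mathcal{B}_{n,k})^*,\qquad \mathcal{R}_{n,k}=\frac{1}{[k]!_q}\,\mathcal{B}^*_{n,k}\mathcal{B}_{n,k},$$ where $[k]!_q=\prod_{j=1}^k(1+q+\cdots+q^{j-1})$. For $x\in\mathcal{H}_n$ write $\ker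 x=\{y\in\mathcal{H}_n: yx=0\}$ and $\operatorname{im} x=\mathcal{H}_n x$ (right action of $x$ on $\mathcal{H}_n$). Then: 1. if $a\in\mathcal{H}_n$ satisfies $a^*a=0$, then $a=0$; 2. $\ker\mathcal{R}_{n,k}=\ker\mathcal{B}^*_{n,k}$ and $\operatorname{im}\mathcal{R}_{n,k}=\operatorname{im}\mathcal{B}_{n,k}$ for all $k\ge 0$; 3. $\ker\mathcal{R}_{n,0}\subseteq\ker\mathcal{R}_{n,1}\subseteq\ker\mathcal{R}_{n,2}\subseteq\cdots$; 4. $\mathcal{H}_n=\operatorname{im}\mathcal{R}_{n,0}\supseteq\operatorname{im}\mathcal{R}_{n,1}\supseteq\operatorname{im}\mathcal{R}_{n,2}\supseteq\cdots$; 5. $\mathcal{H}_n$ has a $\mathbf{k}$-basis consisting of common eigenvectors of the right actions of all $\mathcal{R}_{n,k}$, $k\ge 0$. -/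

import Mathlib

namespace Hecke

variable (K : Type*) [Field K] (q : K) (n : ℕ)

/-- The index set `{1, …, n - 1}` of the generators. -/
abbrev GenIdx (n : ℕ) : Type := {i : ℕ // 0 < i ∧ i < n}

/-- The defining relations of the type-`A` Iwahori--Hecke algebra. -/
inductive Rel : FreeAlgebra K (GenIdx n) → FreeAlgebra K (GenIdx n) → Prop
  | quad (i : GenIdx n) :
      Rel (FreeAlgebra.ι K i * FreeAlgebra.ι K i)
        ((q - 1) • FreeAlgebra.ι K i + algebraMap K _ q)
  | comm (i j : GenIdx n) (h : i.1 + 1 < j.1 ∨ j.1 + 1 < i.1) :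
      Rel (FreeAlgebra.ι K i * FreeAlgebra.ι K j) (FreeAlgebra.ι K j * FreeAlgebra.ι K i)
  | braid (i j : GenIdx n) (h : j.1 = i.1 + 1) :
      Rel (FreeAlgebra.ι K i * FreeAlgebra.ι K j * FreeAlgebra.ι K i)
        (FreeAlgebra.ι K j * FreeAlgebra.ι K i * FreeAlgebra.ι K j)

/-- The Hecke algebra `H_n(q)` over `K`: generators `T_1, …, T_{n-1}`, relations `Rel`. -/
def HeckeAlgebra : Type _ := RingQuot (Rel K q n)

instance : Ring (HeckeAlgebra K q n) := inferInstanceAs (Ring (RingQuot (Rel K q n)))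

instance : Algebra K (HeckeAlgebra K q n) :=
  inferInstanceAs (Algebra K (RingQuot (Rel K q n)))

/-- The quotient map from the free algebra. -/
def mk : FreeAlgebra K (GenIdx n) →ₐ[K] HeckeAlgebra K q n := RingQuot.mkAlgHom K (Rel K q n)

/-- The generator `T_i`, for `1 ≤ i ≤ n - 1` (the value `0` for other `i` is never used). -/
def T (i : ℕ) : HeckeAlgebra K q n :=
  if h : 0 < i ∧ i < n then mk K q n (FreeAlgebra.ι K ⟨i, h⟩) else 0

variable {K q n}

theorem mk_rel {a b : FreeAlgebra K (GenIdx n)} (h : Rel K q n a b) :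
    mk K q n a = mk K q n b :=
  RingQuot.mkAlgHom_rel K h

variable (K q n)

/-- The anti-automorphism `a ↦ a^*` that fixes every `T_i` (equivalently, `T_w ↦ T_{w⁻¹}`),
as an algebra homomorphism to the opposite algebra. -/
def antiHom : HeckeAlgebra K q n →ₐ[K] (HeckeAlgebra K q n)ᵐᵒᵖ :=
  RingQuot.liftAlgHom K
    ⟨FreeAlgebra.lift K fun i : GenIdx n => MulOpposite.op (mk K q n (FreeAlgebra.ι K i)), by
      intro a b h
      cases h with
      | quad i =>
        have := mk_rel (Rel.quad (K := K) (q := q) i)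
        apply MulOpposite.unop_injective
        simpa using this
      | comm i j h =>
        have := mk_rel (Rel.comm (K := K) (q := q) i j h)
        apply MulOpposite.unop_injective
        simpa using this.symm
      | braid i j h =>
        have := mk_rel (Rel.braid (K := K) (q := q) i j h)
        apply MulOpposite.unop_injective
        simpa [mul_assoc] using this⟩

variable {K q n}

/-- The involution `a ↦ a^*` of the Hecke algebra. -/
def heckeStar (a : HeckeAlgebra K q n) : HeckeAlgebra K q n :=
  MulOpposite.unop (antiHom K q n a)

theorem heckeStar_mul (a b : HeckeAlgebra K q n) :
    heckeStar (a * b) = heckeStar b * heckeStar a := by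
  simp [heckeStar]

theorem heckeStar_T (i : ℕ) : heckeStar (T K q n i) = T K q n i := by
  unfold T heckeStar
  split_ifs with h
  · have : antiHom K q n (mk K q n (FreeAlgebra.ι K ⟨i, h⟩)) =
        MulOpposite.op (mk K q n (FreeAlgebra.ι K ⟨i, h⟩)) := by
      unfold antiHom mk
      erw [RingQuot.liftAlgHom_mkAlgHom_apply]
      simp
    rw [this, MulOpposite.unop_op]
  · simp

variable (K q n)

/-- For `m ≤ n`, the element `B_m = ∑_{i=1}^m T_{m-1} T_{m-2} ⋯ T_i`, viewed in `H_n`.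
It is `0` for `m = 0`. -/
def B (m : ℕ) : HeckeAlgebra K q n :=
  ∑ i ∈ Finset.Icc 1 m, ((List.range' i (m - i)).reverse.map (T K q n)).prod

/-- The `k`-bottom-to-random shuffle `B_{n,k} = B_{n-(k-1)} ⋯ B_{n-1} B_n`. Factors with a
nonpositive index are `0`; truncated subtraction agrees with this because `B_0 = 0`. -/
def Bk (k : ℕ) : HeckeAlgebra K q n :=
  ((List.range k).reverse.map fun j => B K q n (n - j)).prod

/-- The `k`-random-to-bottom shuffle `B^*_{n,k} = (B_{n,k})^*`. -/
def BkStar (k : ℕ) : HeckeAlgebra K q n := heckeStar (Bk K q n k)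

variable {K}

/-- The `q`-integer `[k]_q = 1 + q + ⋯ + q^{k-1}`. -/
def qInt (k : ℕ) : K := ∑ i ∈ Finset.range k, q ^ i

/-- The `q`-factorial `[k]!_q = [1]_q [2]_q ⋯ [k]_q`. -/
def qFactorial (k : ℕ) : K := ∏ i ∈ Finset.range k, qInt q (i + 1)

variable (K)

/-- The `k`-random-to-random shuffle `R_{n,k} = (1 / [k]!_q) B^*_{n,k} B_{n,k}`, for `q` with
`[k]!_q ≠ 0` (in particular for every positive real `q`). -/
def Rk (k : ℕ) : HeckeAlgebra K q n :=
  (qFactorial q k)⁻¹ • (BkStar K q n k * Bk K q n k)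

variable {K q n}

/-- The kernel `{y | y x = 0}` of the right action of `x` on the Hecke algebra. -/
def rker (x : HeckeAlgebra K q n) : Submodule K (HeckeAlgebra K q n) :=
  LinearMap.ker (LinearMap.mulRight K x)

/-- The image `{y x | y ∈ H_n}` of the right action of `x` on the Hecke algebra. -/
def rim (x : HeckeAlgebra K q n) : Submodule K (HeckeAlgebra K q n) :=
  LinearMap.range (LinearMap.mulRight K x)

end Hecke

/-! The algebra acts on real functions on the symmetric group by the regular representation,
rescaled by powers of `√q` so that every `T_i` becomes a symmetric operator. Then `*` is the
transpose, and the delta function `δ` at the identity is a separating vector; so `a* a = 0` gives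
`|a δ|² = 0` and hence `a = 0`. This anisotropy yields `ker (b b*) = ker b`, and rank-nullity turns
that into the statement about images. Both chains come from `B_{n,k+1} = B_{n-k} B_{n,k}`.

For the eigenbasis the real spectral theorem is not enough, because the eigenvalues must lie in `K`.
The engine is the recursion `B_{m+1} R_{m+1,k+1} = M B_{m+1}` (`B_mul_randomToRandom`), where `M` is
built from the `R_{m,j}` and a Jucys-Murphy element that commutes with `H_m`. By induction on `m` it
makes the `R_{m,k}` commute, and it carries annihilating polynomials that split over `K` from `M` to
`R_{m+1,k+1}`. For the Jucys-Murphy elements such polynomials come from an intertwiner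
(`intertwiner_aux`). Anisotropy excludes nilpotency in self-adjoint elements, so a split
annihilating polynomial already gives diagonalizability (`Anisotropic.isDiag`), and commuting
diagonalizable self-adjoint elements have spanning joint eigenvectors. -/

namespace Hecke

/-! ### Generators, the involution, Jucys-Murphy elements and quadratic identities for `B_m` -/

section Basics

variable {K : Type*} [Field K] {q : K} {n : ℕ}

theorem T_eq_zero {i : ℕ} (h : ¬(0 < i ∧ i < n)) : T K q n i = 0 := by
  simp [T, h]

theorem T_mul_self {i : ℕ} (h0 : 0 < i) (hn : i < n) :
    T K q n i * T K q n i = (q - 1) • T K q n i + q • 1 := by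
  have := mk_rel (Rel.quad (K := K) (q := q) (⟨i, h0, hn⟩ : GenIdx n))
  simpa [T, h0, hn, Algebra.algebraMap_eq_smul_one] using this

theorem T_comm {i j : ℕ} (h : i + 1 < j) : Commute (T K q n i) (T K q n j) := by
  by_cases hi : 0 < i ∧ i < n
  · by_cases hj : 0 < j ∧ j < n
    · have := mk_rel (Rel.comm (K := K) (q := q) (⟨i, hi⟩ : GenIdx n) ⟨j, hj⟩ (Or.inl h))
      simpa [T, hi, hj, Commute, SemiconjBy] using this
    · simp [T_eq_zero hj]
  · simp [T_eq_zero hi]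

theorem T_braid (i : ℕ) :
    T K q n i * (T K q n (i + 1) * T K q n i) =
      T K q n (i + 1) * (T K q n i * T K q n (i + 1)) := by
  by_cases hi : 0 < i ∧ i < n
  · by_cases hj : 0 < i + 1 ∧ i + 1 < n
    · have := mk_rel (Rel.braid (K := K) (q := q) (⟨i, hi⟩ : GenIdx n) ⟨i + 1, hj⟩ rfl)
      simpa [T, hi, hj, mul_assoc] using this
    · simp [T_eq_zero hj]
  · simp [T_eq_zero hi]

theorem mk_surjective : Function.Surjective (mk K q n) := RingQuot.mkAlgHom_surjective K _

theorem induction {p : HeckeAlgebra K q n → Prop} (hK : ∀ c : K, p (algebraMap K _ c))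
    (hT : ∀ i, p (T K q n i)) (hmul : ∀ a b, p a → p b → p (a * b))
    (hadd : ∀ a b, p a → p b → p (a + b)) (a : HeckeAlgebra K q n) : p a := by
  obtain ⟨a, rfl⟩ := mk_surjective a
  induction a using FreeAlgebra.induction with
  | grade0 c => simpa using hK c
  | grade1 i => simpa [T, i.2] using hT i.1
  | mul a b ha hb => simpa using hmul _ _ ha hb
  | add a b ha hb => simpa using hadd _ _ ha hb

@[simp] theorem heckeStar_zero : heckeStar (0 : HeckeAlgebra K q n) = 0 := by simp [heckeStar]

@[simp] theorem heckeStar_one : heckeStar (1 : HeckeAlgebra K q n) = 1 := by simp [heckeStar]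

theorem heckeStar_add (a b : HeckeAlgebra K q n) :
    heckeStar (a + b) = heckeStar a + heckeStar b := by simp [heckeStar]

theorem heckeStar_sub (a b : HeckeAlgebra K q n) :
    heckeStar (a - b) = heckeStar a - heckeStar b := by simp [heckeStar]

theorem heckeStar_smul (c : K) (a : HeckeAlgebra K q n) :
    heckeStar (c • a) = c • heckeStar a := by simp [heckeStar]

@[simp] theorem heckeStar_algebraMap (c : K) :
    heckeStar (algebraMap K (HeckeAlgebra K q n) c) = algebraMap K _ c := by
  simp [Algebra.algebraMap_eq_smul_one, heckeStar_smul]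

@[simp] theorem heckeStar_heckeStar (a : HeckeAlgebra K q n) :
    heckeStar (heckeStar a) = a := by
  induction a using induction with
  | hK c => simp
  | hT i => simp [heckeStar_T]
  | hmul a b ha hb => rw [heckeStar_mul, heckeStar_mul, ha, hb]
  | hadd a b ha hb => rw [heckeStar_add, heckeStar_add, ha, hb]

@[simp] theorem B_zero : B K q n 0 = 0 := by simp [B]

theorem B_succ (m : ℕ) : B K q n (m + 1) = T K q n m * B K q n m + 1 := by
  unfold B
  rw [Finset.sum_Icc_succ_top (by omega), Finset.mul_sum]
  congr 1
  · refine Finset.sum_congr rfl fun i hi => ?_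
    rw [Finset.mem_Icc] at hi
    have h : m + 1 - i = (m - i) + 1 := by omega
    have h' : i + 1 * (m - i) = m := by omega
    rw [h, List.range'_concat, h', List.reverse_concat]
    simp
  · simp

theorem heckeStar_B_succ (m : ℕ) :
    heckeStar (B K q n (m + 1)) = heckeStar (B K q n m) * T K q n m + 1 := by
  rw [B_succ, heckeStar_add, heckeStar_mul, heckeStar_T, heckeStar_one]

variable (K q n)

/-- The subalgebra of `H_n` generated by `T_1, …, T_{m-1}`. -/
def parabolic (m : ℕ) : Subalgebra K (HeckeAlgebra K q n) :=
  Algebra.adjoin K (T K q n '' {i | i < m})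

/-- The scaled Jucys--Murphy element `q^m J_m = ∑_{i<m} q^i T_{m-1} ⋯ T_i ⋯ T_{m-1}`. -/
def jucysMurphy : ℕ → HeckeAlgebra K q n
  | 0 => 0
  | m + 1 => T K q n m * jucysMurphy m * T K q n m + q ^ m • T K q n m

variable {K q n}

theorem parabolic_mono {m l : ℕ} (h : m ≤ l) : parabolic K q n m ≤ parabolic K q n l :=
  Algebra.adjoin_mono (Set.image_mono fun _ hi => lt_of_lt_of_le hi h)

theorem T_mem_parabolic {i m : ℕ} (h : i < m) : T K q n i ∈ parabolic K q n m :=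
  Algebra.subset_adjoin ⟨i, h, rfl⟩

theorem commute_of_mem_parabolic {m : ℕ} {x a : HeckeAlgebra K q n}
    (h : ∀ i < m, Commute (T K q n i) x) (ha : a ∈ parabolic K q n m) : Commute a x := by
  induction ha using Algebra.adjoin_induction with
  | mem y hy =>
    obtain ⟨i, hi, rfl⟩ := hy
    exact h i hi
  | algebraMap c => exact Algebra.commutes c x
  | add a b _ _ ha hb => exact ha.add_left hb
  | mul a b _ _ ha hb => exact ha.mul_left hb

theorem commute_T_of_mem_parabolic {m : ℕ} {a : HeckeAlgebra K q n}
    (ha : a ∈ parabolic K q n m) : Commute a (T K q n (m + 1)) :=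
  commute_of_mem_parabolic (fun _ hi => T_comm (by omega)) ha

theorem heckeStar_mem_parabolic {m : ℕ} {a : HeckeAlgebra K q n}
    (ha : a ∈ parabolic K q n m) : heckeStar a ∈ parabolic K q n m := by
  induction ha using Algebra.adjoin_induction with
  | mem y hy =>
    obtain ⟨i, hi, rfl⟩ := hy
    rw [heckeStar_T]
    exact T_mem_parabolic hi
  | algebraMap c => simp
  | add a b _ _ ha hb => rw [heckeStar_add]; exact add_mem ha hb
  | mul a b _ _ ha hb => rw [heckeStar_mul]; exact mul_mem hb ha

theorem B_mem_parabolic (m : ℕ) : B K q n m ∈ parabolic K q n m := by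
  induction m with
  | zero => simp
  | succ m ih =>
    rw [B_succ]
    exact add_mem (mul_mem (T_mem_parabolic m.lt_succ_self) (parabolic_mono m.le_succ ih))
      (one_mem _)

theorem jucysMurphy_mem_parabolic (m : ℕ) : jucysMurphy K q n m ∈ parabolic K q n m := by
  induction m with
  | zero => simp [jucysMurphy]
  | succ m ih =>
    have hT := T_mem_parabolic (K := K) (q := q) (n := n) m.lt_succ_self
    exact add_mem (mul_mem (mul_mem hT (parabolic_mono m.le_succ ih)) hT)
      (Subalgebra.smul_mem _ hT _)

theorem heckeStar_jucysMurphy (m : ℕ) :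
    heckeStar (jucysMurphy K q n m) = jucysMurphy K q n m := by
  induction m with
  | zero => simp [jucysMurphy]
  | succ m ih =>
    simp only [jucysMurphy, heckeStar_add, heckeStar_mul, heckeStar_smul, heckeStar_T, ih,
      mul_assoc]

/-- The commutation of `q^{m+2} J_{m+2}` with `T_m`, in terms of `s = T_m` and `t = T_{m+1}`. -/
theorem commute_braid_aux {A : Type*} [Ring A] [Algebra K A] {s t x : A} {q p : K}
    (hs : s * s = (q - 1) • s + q • 1) (hb : s * (t * s) = t * (s * t)) (hx : x * t = t * x) :
    Commute s (t * (s * x * s + p • s) * t + (q * p) • t) := by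
  have hb1 : ∀ y, s * (t * (s * y)) = t * (s * (t * y)) := fun y => by
    simpa only [mul_assoc] using congrArg (· * y) hb
  have hs1 : ∀ y, s * (s * y) = (q - 1) • (s * y) + q • y := fun y => by
    simpa only [mul_assoc, add_mul, smul_mul_assoc, one_mul] using congrArg (· * y) hs
  have hx1 : ∀ y, x * (t * y) = t * (x * y) := fun y => by
    simpa only [mul_assoc] using congrArg (· * y) hx
  have e1 : s * (t * (s * (x * (s * t)))) = t * (s * (x * (s * (t * s)))) := by
    rw [hb1, hb, hx1]
  have e2 : s * (t * (s * t)) = (q - 1) • (s * (t * s)) + q • (t * s) := by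
    rw [← hb, hs1]
  have e3 : t * (s * (t * s)) = (q - 1) • (s * (t * s)) + q • (s * t) := by
    rw [← hb1 s, hs]
    simp only [mul_add, mul_smul_comm, mul_one]
  simp only [Commute, SemiconjBy, mul_add, add_mul, mul_smul_comm, smul_mul_assoc, mul_assoc,
    e1, e2, e3]
  module

theorem commute_T_jucysMurphy_of_lt {i m : ℕ} (h : m < i) :
    Commute (T K q n i) (jucysMurphy K q n m) :=
  (commute_of_mem_parabolic (fun _ hj => T_comm (by omega))
    (jucysMurphy_mem_parabolic m)).symm

theorem commute_T_jucysMurphy {i m : ℕ} (h : i < m) :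
    Commute (T K q n i) (jucysMurphy K q n (m + 1)) := by
  induction m with
  | zero => omega
  | succ m ih =>
    rcases Nat.lt_succ_iff_lt_or_eq.mp h with h | rfl
    · have h1 : Commute (T K q n i) (T K q n (m + 1)) := T_comm (by omega)
      exact ((h1.mul_right (ih h)).mul_right h1).add_right (h1.smul_right _)
    · by_cases hi : 0 < i ∧ i < n
      · have := commute_braid_aux (p := q ^ i) (T_mul_self hi.1 hi.2) (T_braid (K := K) (q := q) i)
          (commute_T_jucysMurphy_of_lt i.lt_succ_self).symm.eq
        rwa [← pow_succ'] at this
      · simp [T_eq_zero hi]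

theorem commute_jucysMurphy {m : ℕ} {a : HeckeAlgebra K q n} (ha : a ∈ parabolic K q n m) :
    Commute a (jucysMurphy K q n (m + 1)) :=
  commute_of_mem_parabolic (fun _ hi => commute_T_jucysMurphy hi) ha

/-- `B_m B_{m+1}` moves two strands to the bottom in either order, so it should be left divisible by
`1 + T_m`, and `T_m (1 + T_m) = q (1 + T_m)`. The induction avoids the factorization and uses the
braid relation directly. -/
theorem T_mul_B_mul_B {m : ℕ} (hm : m < n) :
    T K q n m * (B K q n m * B K q n (m + 1)) = q • (B K q n m * B K q n (m + 1)) := by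
  induction m with
  | zero => simp
  | succ m ih =>
    specialize ih (by omega)
    have hc := (commute_T_of_mem_parabolic (B_mem_parabolic (K := K) (q := q) (n := n) m)).eq
    have hb := T_braid (K := K) (q := q) (n := n) m
    have ht := T_mul_self (K := K) (q := q) m.succ_pos hm
    have hB := B_succ (K := K) (q := q) (n := n) m
    rw [B_succ (m + 1)]
    generalize B K q n (m + 1) = b at *
    generalize B K q n m = c at *
    generalize T K q n (m + 1) = t at *
    generalize T K q n m = s at *
    have e1 : s * (t * (s * (c * b))) = q • (s * (c * (t * b))) := by
      rw [ih, mul_smul_comm, mul_smul_comm, ← mul_assoc c t, hc, mul_assoc]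
    have e4 : b * (t * b) = s * (c * (t * b)) + t * b := by
      rw [← mul_assoc s, ← add_one_mul, ← hB]
    have e2 : t * (b * (t * b)) = s * (t * (s * (c * b))) + t * (t * b) := by
      have hb' : ∀ y, s * (t * (s * y)) = t * (s * (t * y)) := fun y => by
        simpa only [mul_assoc] using congrArg (· * y) hb
      have hc' : c * (t * b) = t * (c * b) := by rw [← mul_assoc, hc, mul_assoc]
      rw [e4, mul_add, hc', hb']
    have e3 : t * (t * b) = (q - 1) • (t * b) + q • b := by
      rw [← mul_assoc, ht, add_mul, smul_mul_assoc, smul_mul_assoc, one_mul]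
    rw [mul_add, mul_one, mul_add, e2, e1, e3, e4]
    module

@[simp] theorem qInt_one : qInt q 1 = 1 := by simp [qInt]

theorem qInt_succ (k : ℕ) : qInt q (k + 1) = qInt q k + q ^ k := Finset.sum_range_succ _ _

theorem qInt_succ' (k : ℕ) : qInt q (k + 1) = q * qInt q k + 1 := by
  simp only [qInt, Finset.sum_range_succ', Finset.mul_sum, pow_succ', pow_zero]

theorem qInt_add (a k : ℕ) : qInt q (a + k) = qInt q a + q ^ a * qInt q k := by
  simp only [qInt, Finset.sum_range_add, Finset.mul_sum, pow_add]

/-- The case `k = 0` of the recursion rests on this identity. Expanding `B_{m+2} = T_{m+1} B_{m+1} +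
1` conjugates the previous identity by `T_{m+1}`, which reproduces the recursion of the Jucys-Murphy
elements; the other terms are recombined by the braid and quadratic relations. -/
theorem B_mul_heckeStar_B {m : ℕ} (hm : m < n) :
    B K q n (m + 1) * heckeStar (B K q n (m + 1)) =
      qInt q (m + 1) • 1 + jucysMurphy K q n (m + 1) +
        heckeStar (B K q n m) * (T K q n m * B K q n m) := by
  induction m with
  | zero => simp [B_succ, jucysMurphy, T_eq_zero]
  | succ m ih =>
    specialize ih (by omega)
    have hc := (commute_T_of_mem_parabolic (B_mem_parabolic (K := K) (q := q) (n := n) m)).eq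
    have hc' := (commute_T_of_mem_parabolic
      (heckeStar_mem_parabolic (B_mem_parabolic (K := K) (q := q) (n := n) m))).eq
    have hb := T_braid (K := K) (q := q) (n := n) m
    have ht := T_mul_self (K := K) (q := q) m.succ_pos hm
    have hB := B_succ (K := K) (q := q) (n := n) m
    have hB' := heckeStar_B_succ (K := K) (q := q) (n := n) m
    rw [heckeStar_B_succ (m + 1), B_succ (m + 1), jucysMurphy, qInt_succ' (m + 1)]
    have hQ := qInt_succ (q := q) (m + 1)
    rw [qInt_succ' (m + 1)] at hQ
    generalize B K q n (m + 1) = b at *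
    generalize heckeStar b = b' at *
    generalize jucysMurphy K q n (m + 1) = l at *
    generalize B K q n m = c at *
    generalize heckeStar c = c' at *
    generalize T K q n (m + 1) = t at *
    generalize T K q n m = s at *
    generalize qInt q (m + 1) = Q at *
    have e1 : b' * (t * b) = t * (c' * (s * (c * t))) + b' * t + t * b - t := by
      -- `t = T_{m+1}` commutes with `c` and `c'`, which lie in `H_m`, so the two outer factors `t`
      -- meet `s` and the braid relation applies.
      have : t * (c' * (s * (c * t))) = c' * (s * (t * (s * c))) := by
        rw [hc, ← mul_assoc t, ← hc', mul_assoc, ← mul_assoc s t c, ← mul_assoc t, ← hb]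
        simp only [mul_assoc]
      rw [this, hB, hB']
      simp only [mul_add, add_mul, mul_one, one_mul, mul_assoc]
      abel
    have e2 : (t * b + 1) * (b' * t + 1) = t * (b * b') * t + t * b + b' * t + 1 := by
      simp only [mul_add, add_mul, mul_one, one_mul, mul_assoc]
      abel
    rw [e1, e2, ih]
    simp only [mul_add, add_mul, mul_one, mul_assoc, mul_smul_comm, smul_mul_assoc, ht]
    linear_combination (norm := module) hQ • t

end Basics

end Hecke

/-! ### The recursion for random-to-random shuffles and their commutativity -/

namespace Hecke

section Shuffles

variable (K : Type*) [Field K] (q : K) (n : ℕ)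

/-- The `k`-bottom-to-random shuffle `B_{m,k}` of `H_m`, viewed in `H_n`. -/
def bottomToRandom (m k : ℕ) : HeckeAlgebra K q n :=
  ((List.range k).reverse.map fun j => B K q n (m - j)).prod

/-- The `k`-random-to-random shuffle `R_{m,k}` of `H_m`, viewed in `H_n`. -/
def randomToRandom (m k : ℕ) : HeckeAlgebra K q n :=
  (qFactorial q k)⁻¹ • (heckeStar (bottomToRandom K q n m k) * bottomToRandom K q n m k)

variable {K q n}

@[simp] theorem bottomToRandom_zero_right (m : ℕ) : bottomToRandom K q n m 0 = 1 := by
  simp [bottomToRandom]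

theorem bottomToRandom_succ (m k : ℕ) :
    bottomToRandom K q n m (k + 1) = bottomToRandom K q n (m - 1) k * B K q n m := by
  simp only [bottomToRandom, List.range_succ_eq_map, List.reverse_cons, List.map_append,
    List.prod_append, ← List.map_reverse, List.map_map]
  congr 2
  · refine List.map_congr_left fun j _ => ?_
    simp [Nat.sub_sub, add_comm]
  · simp

theorem bottomToRandom_succ' (m k : ℕ) :
    bottomToRandom K q n m (k + 1) = B K q n (m - k) * bottomToRandom K q n m k := by
  simp [bottomToRandom, List.range_succ]

@[simp] theorem randomToRandom_zero_right (m : ℕ) : randomToRandom K q n m 0 = 1 := by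
  simp [randomToRandom, qFactorial]

@[simp] theorem randomToRandom_zero_succ (k : ℕ) : randomToRandom K q n 0 (k + 1) = 0 := by
  simp [randomToRandom, bottomToRandom_succ]

theorem randomToRandom_succ (m k : ℕ) :
    randomToRandom K q n (m + 1) (k + 1) = (qInt q (k + 1))⁻¹ •
      (heckeStar (B K q n (m + 1)) * (randomToRandom K q n m k * B K q n (m + 1))) := by
  simp only [randomToRandom, bottomToRandom_succ, heckeStar_mul, qFactorial,
    Finset.prod_range_succ, mul_inv, Nat.add_sub_cancel, smul_mul_assoc, mul_smul_comm, smul_smul,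
    mul_assoc]
  rw [mul_comm]

theorem heckeStar_randomToRandom (m k : ℕ) :
    heckeStar (randomToRandom K q n m k) = randomToRandom K q n m k := by
  simp [randomToRandom, heckeStar_smul, heckeStar_mul]

theorem bottomToRandom_mem_parabolic (m k : ℕ) :
    bottomToRandom K q n m k ∈ parabolic K q n m := by
  refine list_prod_mem fun x hx => ?_
  obtain ⟨j, -, rfl⟩ := List.mem_map.mp hx
  exact parabolic_mono (Nat.sub_le m j) (B_mem_parabolic _)

theorem randomToRandom_mem_parabolic (m k : ℕ) :
    randomToRandom K q n m k ∈ parabolic K q n m :=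
  Subalgebra.smul_mem _ (mul_mem (heckeStar_mem_parabolic (bottomToRandom_mem_parabolic m k))
    (bottomToRandom_mem_parabolic m k)) _

theorem randomToRandom_eq_zero {m k : ℕ} (h : m < k) : randomToRandom K q n m k = 0 := by
  have : bottomToRandom K q n m k = 0 := by
    refine List.prod_eq_zero (List.mem_map.mpr ⟨m, by simpa using h, by simp⟩)
  simp [randomToRandom, this]

variable (K q n)

/-- The element `M` of `H_m` with `B_m R_{m,k+1} = M B_m`, for `m = l + 1`. -/
def recursionElt (l k : ℕ) : HeckeAlgebra K q n :=
  q ^ (k + 1) • randomToRandom K q n l (k + 1) +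
    (qInt q (l + 1 - k) • 1 + (q ^ k)⁻¹ • jucysMurphy K q n (l + 1)) * randomToRandom K q n l k

variable {K q n}

/-- The induction step on `k`, as an identity in an arbitrary algebra. The dictionary is `t =
T_{m+1}`, `b = B_{m+1}`, `c = B_{m+2}`, `x` and `l` the Jucys-Murphy elements of index `m+1` and
`m+2`, `v = R_{m,k}`, `u = R_{m,k+1}`, `r = R_{m+1,k+1}`, `r₁ = R_{m+1,k+2}`, `r₂ = R_{m+2,k+2}`;
primes denote `*`. -/
theorem recursion_step_aux {A : Type*} [Ring A] [Algebra K A] {q : K} (hq : q ≠ 0) {k a N : ℕ}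
    (hN : N = a + k)
    (hk1 : qInt q (k + 1) ≠ 0) (hk2 : qInt q (k + 2) ≠ 0) {t b b' c c' l x u v r r₁ r₂ : A}
    (hr : r = (qInt q (k + 1))⁻¹ • (b' * (v * b)))
    (hr₁ : r₁ = (qInt q (k + 2))⁻¹ • (b' * (u * b)))
    (hr₂ : r₂ = (qInt q (k + 2))⁻¹ • (c' * (r * c)))
    (hb : b * r = (q ^ (k + 1) • u + (qInt q a • 1 + (q ^ k)⁻¹ • x) * v) * b)
    (hc : c * c' = qInt q (N + 1) • 1 + l + b' * (t * b))
    (ht : t * (b * c) = q • (b * c)) (htu : u * t = t * u) (htv : v * t = t * v)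
    (hl : l = t * x * t + q ^ N • t) (hlb : b' * l = l * b') :
    c * r₂ = (q ^ (k + 2) • r₁ + (qInt q a • 1 + (q ^ (k + 1))⁻¹ • l) * r) * c := by
  subst hN
  have e1 : b' * (u * (b * c)) = qInt q (k + 2) • (r₁ * c) := by
    rw [hr₁, smul_mul_assoc, smul_inv_smul₀ hk2]
    simp only [mul_assoc]
  have e2 : b' * (v * (b * c)) = qInt q (k + 1) • (r * c) := by
    rw [hr, smul_mul_assoc, smul_inv_smul₀ hk1]
    simp only [mul_assoc]
  have e3 : b' * (t * (x * (v * (b * c)))) =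
      (q⁻¹ * qInt q (k + 1)) • (l * (r * c)) - (q ^ (a + k) * qInt q (k + 1)) • (r * c) := by
    -- As `t` fixes `b * c` up to the factor `q`, a second `t` can be inserted to the right of `x`;
    -- then `t * x * t` is `l` minus a multiple of `t`.
    have h1 : t * (x * (v * (b * c))) = q⁻¹ • (t * (x * (t * (v * (b * c))))) := by
      rw [← mul_assoc t v, ← htv, mul_assoc v t, ht]
      simp only [mul_smul_comm, inv_smul_smul₀ hq]
    have h2 : t * (x * (t * (v * (b * c)))) =
        l * (v * (b * c)) - (q ^ (a + k) * q) • (v * (b * c)) := by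
      have : t * (v * (b * c)) = q • (v * (b * c)) := by
        rw [← mul_assoc t v, ← htv, mul_assoc v t, ht, mul_smul_comm]
      rw [hl, mul_smul, ← this]
      simp only [add_mul, mul_assoc, smul_mul_assoc]
      abel
    rw [h1, h2, mul_smul_comm, mul_sub, ← mul_assoc b' l, hlb, mul_assoc l, mul_smul_comm, e2,
      smul_sub, mul_smul_comm, smul_smul, smul_smul, smul_smul]
    congr 2
    field_simp
  have e4 : c * r₂ = (qInt q (k + 2))⁻¹ • ((c * c') * (r * c)) := by
    rw [hr₂, mul_smul_comm, mul_assoc]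
  have e5 : b * (r * c) = q ^ (k + 1) • (u * (b * c)) + qInt q a • (v * (b * c)) +
      (q ^ k)⁻¹ • (x * (v * (b * c))) := by
    rw [← mul_assoc, hb]
    simp only [add_mul, mul_assoc, smul_mul_assoc, one_mul, add_assoc]
  have e6 : b' * (t * (u * (b * c))) = q • (b' * (u * (b * c))) := by
    rw [← mul_assoc t u, ← htu, mul_assoc u t, ht, mul_smul_comm, mul_smul_comm]
  have e7 : b' * (t * (v * (b * c))) = q • (b' * (v * (b * c))) := by
    rw [← mul_assoc t v, ← htv, mul_assoc v t, ht, mul_smul_comm, mul_smul_comm]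
  have e8 : b' * (t * b) * (r * c) = b' * (t * (b * (r * c))) := by simp only [mul_assoc]
  rw [e4, hc, inv_smul_eq_iff₀ hk2, add_mul, e8, e5]
  simp only [mul_add, mul_smul_comm, e6, e7, e1, e2, e3, add_mul, smul_mul_assoc, one_mul,
    mul_assoc, smul_add, smul_sub, smul_smul]
  have hQ1 : qInt q (a + k + 1) = qInt q a + q ^ a * qInt q (k + 1) := qInt_add a (k + 1)
  have hQ2 : qInt q (k + 2) = q * qInt q (k + 1) + 1 := qInt_succ' (k + 1)
  have hQ3 : qInt q (k + 2) = qInt q (k + 1) + q ^ (k + 1) := qInt_succ (k + 1)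
  -- The coefficients of `r * c` and `l * (r * c)`. The `q ^ N • t` inside `l` contributes `-q ^ a
  -- [k+1]`, which cancels the tail of `[a+k+1] = [a] + q ^ a [k+1]`.
  have hs1 : qInt q (a + k + 1) + (q ^ 1 * qInt q a * qInt q (k + 1)) -
      (q ^ k)⁻¹ * (q ^ (a + k) * qInt q (k + 1)) = qInt q (k + 2) * qInt q a := by
    rw [hQ1, hQ2, pow_add]
    field_simp
    ring
  have hs2 : 1 + (q ^ k)⁻¹ * (q⁻¹ * qInt q (k + 1)) = qInt q (k + 2) * (q ^ (k + 1))⁻¹ := by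
    rw [hQ3]
    field_simp
    ring
  linear_combination (norm := module) hs1 • (r * c) + hs2 • (l * (r * c))

theorem B_mul_randomToRandom (hq : q ≠ 0) (hqk : ∀ k, qInt q (k + 1) ≠ 0) {m : ℕ} (hm : m < n)
    (k : ℕ) : B K q n (m + 1) * randomToRandom K q n (m + 1) (k + 1) =
      recursionElt K q n m k * B K q n (m + 1) := by
  -- For `m < k` every shuffle involved vanishes, so the truncated subtraction in `recursionElt`
  -- only matters for `k ≤ m`.
  rcases lt_or_ge m k with h | h
  · simp [recursionElt, randomToRandom_eq_zero, h, Nat.lt_succ_of_lt h]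
  rcases k with _ | k
  · have h0 : heckeStar (B K q n m) * B K q n m = randomToRandom K q n m 1 := by
      rcases m with _ | m
      · simp
      · simp [randomToRandom_succ]
    rw [randomToRandom_succ]
    simp only [recursionElt, zero_add, qInt_one, inv_one, one_smul, randomToRandom_zero_right,
      one_mul, mul_one, pow_one, pow_zero, Nat.sub_zero, ← h0]
    rw [← mul_assoc, B_mul_heckeStar_B hm, add_mul, add_mul, mul_assoc (heckeStar _), mul_assoc,
      T_mul_B_mul_B hm, add_mul, add_mul, mul_smul_comm, smul_mul_assoc, smul_mul_assoc, mul_assoc]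
    abel
  · obtain ⟨m, rfl⟩ : ∃ m', m = m' + 1 := ⟨m - 1, by omega⟩
    have ih := B_mul_randomToRandom hq hqk (m := m) (by omega) k
    have h1 : m + 1 + 1 - (k + 1) = m + 1 - k := by omega
    have hu := commute_T_of_mem_parabolic
      (randomToRandom_mem_parabolic (K := K) (q := q) (n := n) m (k + 1))
    have hv := commute_T_of_mem_parabolic
      (randomToRandom_mem_parabolic (K := K) (q := q) (n := n) m k)
    have hl := commute_jucysMurphy
      (heckeStar_mem_parabolic (B_mem_parabolic (K := K) (q := q) (n := n) (m + 1)))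
    rw [recursionElt, h1]
    exact recursion_step_aux hq (a := m + 1 - k) (by omega) (hqk k) (hqk (k + 1))
      (randomToRandom_succ m k) (randomToRandom_succ m (k + 1))
      (randomToRandom_succ (m + 1) (k + 1)) ih (B_mul_heckeStar_B hm) (T_mul_B_mul_B hm) hu.eq
      hv.eq rfl hl.eq

theorem commute_recursionElt {m k : ℕ} {a : HeckeAlgebra K q n} (ha : a ∈ parabolic K q n m)
    (h : ∀ j, Commute a (randomToRandom K q n m j)) : Commute a (recursionElt K q n m k) :=
  ((h _).smul_right _).add_right
    ((((Commute.one_right a).smul_right _).add_right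
      ((commute_jucysMurphy ha).smul_right _)).mul_right (h _))

theorem heckeStar_recursionElt (m k : ℕ) :
    heckeStar (recursionElt K q n m k) = recursionElt K q n m k := by
  have h : Commute (randomToRandom K q n m k)
      (qInt q (m + 1 - k) • 1 + (q ^ k)⁻¹ • jucysMurphy K q n (m + 1)) :=
    ((Commute.one_right _).smul_right _).add_right
      ((commute_jucysMurphy (randomToRandom_mem_parabolic m k)).smul_right _)
  simp only [recursionElt, heckeStar_add, heckeStar_mul, heckeStar_smul, heckeStar_one,
    heckeStar_randomToRandom, heckeStar_jucysMurphy, h.eq]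

theorem randomToRandom_mul_heckeStar_B (hq : q ≠ 0) (hqk : ∀ k, qInt q (k + 1) ≠ 0) {m : ℕ}
    (hm : m < n) (k : ℕ) :
    randomToRandom K q n (m + 1) (k + 1) * heckeStar (B K q n (m + 1)) =
      heckeStar (B K q n (m + 1)) * recursionElt K q n m k := by
  have := congrArg heckeStar (B_mul_randomToRandom hq hqk hm k)
  rwa [heckeStar_mul, heckeStar_mul, heckeStar_randomToRandom, heckeStar_recursionElt] at this

/-- `R_{m+1,k+1}` is a multiple of `B* R_{m,k} B`. Moving `R_{m+1,l+1}` through `B` turns it into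
`M`, which commutes with `R_{m,k}` by induction, and the adjoint recursion moves it out through
`B*`. -/
theorem commute_randomToRandom (hq : q ≠ 0) (hqk : ∀ k, qInt q (k + 1) ≠ 0) {m : ℕ} (hm : m ≤ n)
    (k l : ℕ) : Commute (randomToRandom K q n m k) (randomToRandom K q n m l) := by
  induction m generalizing k l with
  | zero => rcases k with _ | k <;> simp
  | succ m ih =>
    rcases k with _ | k
    · simp
    rcases l with _ | l
    · simp
    have h := commute_recursionElt (k := l) (randomToRandom_mem_parabolic m k)
      (fun j => ih (by omega) k j)
    rw [Commute, SemiconjBy, randomToRandom_succ m k, smul_mul_assoc, mul_smul_comm, mul_assoc,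
      mul_assoc, B_mul_randomToRandom hq hqk (by omega), ← mul_assoc (randomToRandom K q n m k),
      h.eq, ← mul_assoc (randomToRandom K q n (m + 1) (l + 1)),
      randomToRandom_mul_heckeStar_B hq hqk (by omega)]
    simp only [mul_assoc]

end Shuffles

end Hecke

/-! ### Coset decomposition of parabolic subalgebras and finite dimension -/

namespace Hecke

section Parabolic

variable (K : Type*) [Field K] (q : K) (n : ℕ)

/-- The product `T_{m-d+1} ⋯ T_{m-1} T_m` of `d` consecutive generators. -/
def ascending (m : ℕ) : ℕ → HeckeAlgebra K q n
  | 0 => 1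
  | d + 1 => T K q n (m - d) * ascending m d

/-- The sum of the left translates of `H_m` by the coset representatives `T_{m-d+1} ⋯ T_m`. -/
def cosetSum (m : ℕ) : Submodule K (HeckeAlgebra K q n) :=
  ⨆ d ∈ Finset.range (m + 1),
    (Subalgebra.toSubmodule (parabolic K q n m)).map (LinearMap.mulLeft K (ascending K q n m d))

variable {K q n}

theorem ascending_mul_mem_cosetSum {m d : ℕ} (hd : d ≤ m) {h : HeckeAlgebra K q n}
    (hh : h ∈ parabolic K q n m) : ascending K q n m d * h ∈ cosetSum K q n m := by
  refine Submodule.mem_iSup_of_mem d (Submodule.mem_iSup_of_mem (Finset.mem_range.mpr (by omega)) ?_)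
  exact ⟨h, hh, rfl⟩

theorem T_mul_ascending_of_lt {m d i : ℕ} (h : i + d < m) :
    T K q n i * ascending K q n m d = ascending K q n m d * T K q n i := by
  induction d with
  | zero => simp [ascending]
  | succ d ih =>
    rw [ascending, ← mul_assoc, (T_comm (show i + 1 < m - d by omega)).eq, mul_assoc,
      ih (by omega), mul_assoc]

theorem T_mul_ascending_of_gt {m d i : ℕ} (h : m < i + d) (hi : i < m) (hd : d ≤ m) :
    T K q n (i + 1) * ascending K q n m d = ascending K q n m d * T K q n i := by
  induction d with
  | zero => omega
  | succ d ih =>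
    rcases Nat.lt_or_ge m (i + d) with h' | h'
    · rw [ascending, ← mul_assoc, ← (T_comm (show m - d + 1 < i + 1 by omega)).eq, mul_assoc,
        ih h' (by omega), mul_assoc]
    · obtain ⟨d, rfl⟩ : ∃ d', d = d' + 1 := ⟨d - 1, by omega⟩
      have h1 : m - (d + 1) = i := by omega
      have h2 : m - d = i + 1 := by omega
      rw [ascending, ascending, h1, h2, mul_assoc, mul_assoc,
        ← T_mul_ascending_of_lt (show i + d < m by omega)]
      simpa only [mul_assoc] using congrArg (· * ascending K q n m d)
        (T_braid (K := K) (q := q) (n := n) i).symm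

/-- Four cases: `T_i` commutes past the product, lengthens it, shortens it by the quadratic relation
when it meets its own first letter, or passes through as `T_{i-1}` by a braid move. -/
theorem T_mul_ascending_mul_mem {m d i : ℕ} (hd : d ≤ m) (hi : i ≤ m) {h : HeckeAlgebra K q n}
    (hh : h ∈ parabolic K q n m) :
    T K q n i * (ascending K q n m d * h) ∈ cosetSum K q n m := by
  by_cases hin : 0 < i ∧ i < n
  swap
  · simp [T_eq_zero hin]
  rcases lt_trichotomy (i + d) m with h' | rfl | h'
  · rw [← mul_assoc, T_mul_ascending_of_lt h', mul_assoc]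
    exact ascending_mul_mem_cosetSum hd (mul_mem (T_mem_parabolic (by omega)) hh)
  · rw [← mul_assoc]
    have : T K q n i * ascending K q n (i + d) d = ascending K q n (i + d) (d + 1) := by
      rw [ascending, Nat.add_sub_cancel]
    rw [this]
    exact ascending_mul_mem_cosetSum (by omega) hh
  · obtain ⟨d, rfl⟩ : ∃ d', d = d' + 1 := ⟨d - 1, by omega⟩
    rcases Nat.lt_or_ge m (i + d) with h'' | h''
    · obtain ⟨i, rfl⟩ : ∃ i', i = i' + 1 := ⟨i - 1, by omega⟩
      rw [← mul_assoc, T_mul_ascending_of_gt (by omega) (by omega) hd, mul_assoc]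
      exact ascending_mul_mem_cosetSum hd (mul_mem (T_mem_parabolic (by omega)) hh)
    · have h1 : m - d = i := by omega
      have : T K q n i * (ascending K q n m (d + 1) * h) =
          (q - 1) • (ascending K q n m (d + 1) * h) + q • (ascending K q n m d * h) := by
        rw [ascending, h1, ← mul_assoc, ← mul_assoc, T_mul_self hin.1 hin.2]
        simp only [add_mul, smul_mul_assoc, one_mul]
      rw [this]
      exact add_mem (Submodule.smul_mem _ _ (ascending_mul_mem_cosetSum hd hh))
        (Submodule.smul_mem _ _ (ascending_mul_mem_cosetSum (by omega) hh))

theorem T_mul_mem_cosetSum {m i : ℕ} (hi : i ≤ m) {a : HeckeAlgebra K q n}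
    (ha : a ∈ cosetSum K q n m) : T K q n i * a ∈ cosetSum K q n m := by
  have : cosetSum K q n m ≤ (cosetSum K q n m).comap (LinearMap.mulLeft K (T K q n i)) := by
    conv_lhs => rw [cosetSum]
    refine iSup₂_le fun d hd => ?_
    rintro _ ⟨h, hh, rfl⟩
    exact T_mul_ascending_mul_mem (Nat.lt_succ_iff.mp (Finset.mem_range.mp hd)) hi hh
  exact this ha

theorem mul_mem_cosetSum {m : ℕ} {a b : HeckeAlgebra K q n} (ha : a ∈ parabolic K q n (m + 1))
    (hb : b ∈ cosetSum K q n m) : a * b ∈ cosetSum K q n m := by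
  induction ha using Algebra.adjoin_induction generalizing b with
  | mem y hy =>
    obtain ⟨i, hi, rfl⟩ := hy
    exact T_mul_mem_cosetSum (Nat.lt_succ_iff.mp hi) hb
  | algebraMap c =>
    rw [← Algebra.smul_def]
    exact Submodule.smul_mem _ _ hb
  | add x y _ _ hx hy => rw [add_mul]; exact add_mem (hx hb) (hy hb)
  | mul x y _ _ hx hy => rw [mul_assoc]; exact hx (hy hb)

theorem parabolic_succ_le_cosetSum (m : ℕ) :
    Subalgebra.toSubmodule (parabolic K q n (m + 1)) ≤ cosetSum K q n m := by
  intro a ha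
  have h1 : (1 : HeckeAlgebra K q n) ∈ cosetSum K q n m := by
    simpa [ascending] using
      ascending_mul_mem_cosetSum (d := 0) m.zero_le (one_mem (parabolic K q n m))
  simpa using mul_mem_cosetSum ha h1

theorem exists_eq_sum_ascending_mul {m : ℕ} {a : HeckeAlgebra K q n}
    (ha : a ∈ parabolic K q n (m + 1)) : ∃ h : ℕ → HeckeAlgebra K q n,
      (∀ d, h d ∈ parabolic K q n m) ∧
        a = ∑ d ∈ Finset.range (m + 1), ascending K q n m d * h d := by
  have := parabolic_succ_le_cosetSum m ha
  rw [cosetSum, Submodule.mem_iSup_finset_iff_exists_sum] at this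
  obtain ⟨μ, rfl⟩ := this
  choose h hh hμ using fun d => (μ d).2
  exact ⟨h, hh, Finset.sum_congr rfl fun d _ => (hμ d).symm⟩

theorem parabolic_self : parabolic K q n n = ⊤ := by
  refine eq_top_iff.mpr fun a _ => ?_
  induction a using induction with
  | hK c => exact algebraMap_mem _ c
  | hT i =>
    by_cases h : i < n
    · exact T_mem_parabolic h
    · simp [T_eq_zero (show ¬(0 < i ∧ i < n) by omega)]
  | hmul a b ha hb => exact mul_mem (ha trivial) (hb trivial)
  | hadd a b ha hb => exact add_mem (ha trivial) (hb trivial)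

theorem parabolic_zero : parabolic K q n 0 = ⊥ := by simp [parabolic]

theorem parabolic_fg (m : ℕ) : (Subalgebra.toSubmodule (parabolic K q n m)).FG := by
  induction m with
  | zero =>
    rw [parabolic_zero, Algebra.toSubmodule_bot]
    exact ⟨{1}, by simp [Submodule.one_eq_span]⟩
  | succ m ih =>
    have : (cosetSum K q n m).FG := Submodule.fg_biSup _ _ fun d _ => ih.map _
    exact this.of_le (parabolic_succ_le_cosetSum m)

instance : Module.Finite K (HeckeAlgebra K q n) :=
  ⟨by simpa [parabolic_self] using parabolic_fg (K := K) (q := q) (n := n) n⟩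

end Parabolic

end Hecke

/-! ### The symmetric form of the regular representation -/

namespace Hecke

section Representation

/-- The operator by which a generator of the Hecke algebra acts on functions on permutations, in
its symmetric normalization: it mixes the entries in the positions `a` and `b`. -/
noncomputable def mixOp {N : ℕ} (q : ℝ) (a b : Fin N) : Module.End ℝ (Equiv.Perm (Fin N) → ℝ) where
  toFun f w := √q * f (w * Equiv.swap a b) + (if w b < w a then q - 1 else 0) * f w
  map_add' f g := by
    ext w
    simp only [Pi.add_apply]
    ring
  map_smul' c f := by
    ext w
    simp only [Pi.smul_apply, smul_eq_mul, RingHom.id_apply]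
    ring

variable {N : ℕ} {q : ℝ}

theorem mixOp_apply (a b : Fin N) (f : Equiv.Perm (Fin N) → ℝ) (w : Equiv.Perm (Fin N)) :
    mixOp q a b f w = √q * f (w * Equiv.swap a b) + (if w b < w a then q - 1 else 0) * f w := rfl

theorem mixOp_mul_self (hq : 0 ≤ q) {a b : Fin N} (hab : a ≠ b) :
    mixOp q a b * mixOp q a b = (q - 1) • mixOp q a b + q • 1 := by
  refine LinearMap.ext fun f => funext fun w => ?_
  have hs := Real.mul_self_sqrt hq
  have hw : w a ≠ w b := fun h => hab (w.injective h)
  simp only [Module.End.mul_apply, mixOp_apply, LinearMap.add_apply, LinearMap.smul_apply,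
    Module.End.one_apply, Pi.add_apply, Pi.smul_apply, smul_eq_mul, mul_assoc, Equiv.swap_mul_self,
    mul_one, Equiv.Perm.mul_apply, Equiv.swap_apply_left, Equiv.swap_apply_right]
  rcases lt_or_gt_of_ne hw with h | h
  · simp only [h, h.not_gt, if_true, if_false]
    linear_combination hs * f w
  · simp only [h, h.not_gt, if_true, if_false]
    linear_combination hs * f w

theorem mixOp_comm {a b c d : Fin N} (hac : a ≠ c) (had : a ≠ d) (hbc : b ≠ c) (hbd : b ≠ d) :
    mixOp q a b * mixOp q c d = mixOp q c d * mixOp q a b := by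
  refine LinearMap.ext fun f => funext fun w => ?_
  have h : Equiv.swap a b * Equiv.swap c d = Equiv.swap c d * Equiv.swap a b := by
    ext x
    simp only [Equiv.Perm.mul_apply, Equiv.swap_apply_def]
    grind
  simp only [Module.End.mul_apply, mixOp_apply, mul_assoc, h, Equiv.Perm.mul_apply,
    Equiv.swap_apply_of_ne_of_ne hac had, Equiv.swap_apply_of_ne_of_ne hbc hbd,
    Equiv.swap_apply_of_ne_of_ne hac.symm hbc.symm, Equiv.swap_apply_of_ne_of_ne had.symm hbd.symm]
  ring

theorem mixOp_braid (hq : 0 ≤ q) {a b c : Fin N} (hab : a ≠ b) (hac : a ≠ c) (hbc : b ≠ c) :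
    mixOp q a b * mixOp q b c * mixOp q a b = mixOp q b c * mixOp q a b * mixOp q b c := by
  refine LinearMap.ext fun f => funext fun w => ?_
  have hs := Real.mul_self_sqrt hq
  have h : Equiv.swap a b * (Equiv.swap b c * Equiv.swap a b) =
      Equiv.swap b c * (Equiv.swap a b * Equiv.swap b c) := by
    ext x
    simp only [Equiv.Perm.mul_apply, Equiv.swap_apply_def]
    grind
  have h1 : w a ≠ w b := fun h => hab (w.injective h)
  have h2 : w a ≠ w c := fun h => hac (w.injective h)
  have h3 : w b ≠ w c := fun h => hbc (w.injective h)
  simp only [Module.End.mul_apply, mixOp_apply, mul_assoc, h, Equiv.Perm.mul_apply,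
    Equiv.swap_apply_left, Equiv.swap_apply_right, Equiv.swap_mul_self, mul_one,
    Equiv.swap_apply_of_ne_of_ne hac.symm hbc.symm, Equiv.swap_apply_of_ne_of_ne hab hac]
  -- Of the eight sign patterns, two violate transitivity; the other six are the orderings of three
  -- values.
  rcases lt_or_gt_of_ne h1 with h1 | h1 <;> rcases lt_or_gt_of_ne h2 with h2 | h2 <;>
    rcases lt_or_gt_of_ne h3 with h3 | h3 <;>
    first
    | exact absurd (h1.trans h3) h2.not_gt
    | exact absurd (h3.trans h1) h2.not_gt
    | (simp only [h1, h2, h3, h1.not_gt, h2.not_gt, h3.not_gt, if_true, if_false]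
       ring)

theorem mixOp_symm (a b : Fin N) (f g : Equiv.Perm (Fin N) → ℝ) :
    mixOp q a b f ⬝ᵥ g = f ⬝ᵥ mixOp q a b g := by
  have h := Equiv.sum_comp (Equiv.mulRight (Equiv.swap a b)) fun w =>
    √q * f (w * Equiv.swap a b) * g w
  simp only [Equiv.coe_mulRight, mul_assoc, Equiv.swap_mul_self, mul_one] at h
  simp only [dotProduct, mixOp_apply, add_mul, mul_add, Finset.sum_add_distrib]
  congr 1
  · simp only [mul_assoc]
    rw [← h]
    exact Finset.sum_congr rfl fun w _ => by ring
  · exact Finset.sum_congr rfl fun w _ => by ring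

theorem mixOp_injective (hq : 0 < q) {a b : Fin N} (hab : a ≠ b) :
    Function.Injective (mixOp q a b) := by
  rw [← LinearMap.ker_eq_bot, LinearMap.ker_eq_bot']
  intro f hf
  have := congrArg (· f) (mixOp_mul_self hq.le hab)
  simpa [hf, hq.ne'] using this.symm

end Representation

/-! ### Faithfulness and anisotropy of the involution -/

section Faithful

variable {K : Subfield ℝ} (q : K) (n : ℕ)

/-- The operator by which `T_i` acts. -/
noncomputable def genOp (i : GenIdx n) : Module.End ℝ (Equiv.Perm (Fin n) → ℝ) :=
  mixOp (q : ℝ) ⟨i.1 - 1, by omega⟩ ⟨i.1, i.2.2⟩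

/-- The representation of the Hecke algebra on functions on permutations. -/
noncomputable def rep (hq : 0 < (q : ℝ)) :
    HeckeAlgebra K q n →ₐ[K] Module.End ℝ (Equiv.Perm (Fin n) → ℝ) :=
  RingQuot.liftAlgHom K
    ⟨FreeAlgebra.lift K (genOp q n), by
      intro a b h
      cases h with
      | quad i =>
        have hi := i.2
        have := mixOp_mul_self hq.le (a := (⟨i.1 - 1, by omega⟩ : Fin n)) (b := ⟨i.1, i.2.2⟩)
          (by simp [Fin.ext_iff]; omega)
        simp only [map_mul, FreeAlgebra.lift_ι_apply, map_add, map_smul, AlgHom.commutes]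
        exact this
      | comm i j h =>
        have hi := i.2
        have hj := j.2
        simp only [map_mul, FreeAlgebra.lift_ι_apply]
        apply mixOp_comm <;> simp [Fin.ext_iff] <;> omega
      | braid i j h =>
        have hi := i.2
        have hj := j.2
        have hj' : (⟨j.1 - 1, by omega⟩ : Fin n) = ⟨i.1, i.2.2⟩ := by simp [h]
        simp only [map_mul, FreeAlgebra.lift_ι_apply, genOp, hj']
        apply mixOp_braid hq.le <;> simp [Fin.ext_iff] <;> omega⟩

variable {q n} (hq : 0 < (q : ℝ))

theorem rep_T (i : GenIdx n) : rep q n hq (T K q n i.1) = genOp q n i := by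
  have : rep q n hq (mk K q n (FreeAlgebra.ι K i)) = genOp q n i := by
    unfold rep mk
    erw [RingQuot.liftAlgHom_mkAlgHom_apply]
    simp
  simpa [T, i.2] using this

theorem rep_heckeStar (a : HeckeAlgebra K q n) (f g : Equiv.Perm (Fin n) → ℝ) :
    rep q n hq (heckeStar a) f ⬝ᵥ g = f ⬝ᵥ rep q n hq a g := by
  induction a using induction generalizing f g with
  | hK c => simp [Algebra.algebraMap_eq_smul_one, heckeStar_smul, smul_dotProduct, dotProduct_smul]
  | hT i =>
    rw [heckeStar_T]
    by_cases hi : 0 < i ∧ i < n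
    · rw [rep_T hq ⟨i, hi⟩]
      exact mixOp_symm _ _ f g
    · simp [T_eq_zero hi]
  | hmul a b ha hb => simp only [heckeStar_mul, map_mul, Module.End.mul_apply, ha, hb]
  | hadd a b ha hb =>
    simp only [heckeStar_add, map_add, LinearMap.add_apply, add_dotProduct, dotProduct_add, ha, hb]

/-- The functions supported on the permutations that fix every `l > m` and take the value `m` at
`j`. -/
def SupportedAt (m j : ℕ) (f : Equiv.Perm (Fin n) → ℝ) : Prop :=
  ∀ w, f w ≠ 0 → (∀ h : j < n, (w ⟨j, h⟩ : ℕ) = m) ∧ ∀ l : Fin n, m < l → w l = l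

/-- The functions supported on the permutations that fix every `l ≥ m`. -/
def SupportedBelow (m : ℕ) (f : Equiv.Perm (Fin n) → ℝ) : Prop :=
  ∀ w, f w ≠ 0 → ∀ l : Fin n, m ≤ l → w l = l

theorem SupportedBelow.supportedAt {m : ℕ} {f : Equiv.Perm (Fin n) → ℝ} (h : SupportedBelow m f) :
    SupportedAt m m f := fun w hw =>
  ⟨fun hm => by rw [h w hw ⟨m, hm⟩ le_rfl], fun l hl => h w hw l hl.le⟩

theorem SupportedBelow.genOp {m : ℕ} {f : Equiv.Perm (Fin n) → ℝ} (h : SupportedBelow m f)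
    (i : GenIdx n) (hi : i.1 < m) : SupportedBelow m (genOp q n i f) := by
  intro w hw l hl
  by_cases h1 : f w = 0
  · have h2 : f (w * Equiv.swap ⟨i.1 - 1, by omega⟩ ⟨i.1, i.2.2⟩) ≠ 0 := by
      intro h2
      exact hw (by simp [Hecke.genOp, mixOp_apply, h1, h2])
    have := h _ h2 l hl
    rwa [Equiv.Perm.mul_apply, Equiv.swap_apply_of_ne_of_ne] at this <;>
      simp only [ne_eq, Fin.ext_iff] <;> omega
  · exact h w h1 l hl

/-- `T_i` moves the value `m` from position `i` to position `i - 1`. The diagonal term of the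
operator cannot leave anything behind, since `m` is the largest value not forced to be fixed. -/
theorem SupportedAt.genOp {m : ℕ} {f : Equiv.Perm (Fin n) → ℝ} (i : GenIdx n)
    (h : SupportedAt m i.1 f) (hi : i.1 ≤ m) : SupportedAt m (i.1 - 1) (genOp q n i f) := by
  have hi0 := i.2.1
  have hin := i.2.2
  intro w hw
  have h2 : f (w * Equiv.swap ⟨i.1 - 1, by omega⟩ ⟨i.1, i.2.2⟩) ≠ 0 := by
    intro h2
    rw [Hecke.genOp, mixOp_apply, h2, mul_zero, zero_add] at hw
    -- A surviving diagonal term needs a descent, so `w` would take a value above `m` at `i - 1`;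
    -- that value is a fixed point, forcing it to equal `i - 1 < m`.
    obtain ⟨h3, h4⟩ := h w (right_ne_zero_of_mul hw)
    specialize h3 hin
    have h5 := left_ne_zero_of_mul hw
    rw [ite_ne_right_iff] at h5
    have h6 : m < (w ⟨i.1 - 1, by omega⟩ : ℕ) := by
      rw [← h3]
      exact h5.1
    have h7 := w.injective (h4 _ h6)
    rw [h7] at h6
    simp only at h6
    omega
  obtain ⟨h3, h4⟩ := h _ h2
  refine ⟨fun h' => ?_, fun l hl => ?_⟩
  · simpa using h3 hin
  · have := h4 l hl
    rwa [Equiv.Perm.mul_apply, Equiv.swap_apply_of_ne_of_ne] at this <;>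
      simp only [ne_eq, Fin.ext_iff] <;> omega

theorem supportedAt_ascending {m d : ℕ} (hm : m < n) (hd : d ≤ m) {f : Equiv.Perm (Fin n) → ℝ}
    (h : SupportedAt m m f) : SupportedAt m (m - d) (rep q n hq (ascending K q n m d) f) := by
  induction d with
  | zero => simpa [ascending] using h
  | succ d ih =>
    specialize ih (by omega)
    have := SupportedAt.genOp (q := q) ⟨m - d, by omega, by omega⟩ ih (by simp)
    rw [← rep_T hq] at this
    simpa [ascending, Nat.sub_sub] using this

theorem rep_ascending_injective {m d : ℕ} (hm : m < n) (hd : d ≤ m) :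
    Function.Injective (rep q n hq (ascending K q n m d)) := by
  induction d with
  | zero => simpa [ascending] using! Function.injective_id
  | succ d ih =>
    have h : Function.Injective (rep q n hq (T K q n (m - d))) := by
      rw [rep_T hq ⟨m - d, by omega, by omega⟩]
      exact mixOp_injective hq (by simp [Fin.ext_iff]; omega)
    simpa [ascending] using! h.comp (ih (by omega))

theorem supportedBelow_rep {m : ℕ} {a : HeckeAlgebra K q n} (ha : a ∈ parabolic K q n m)
    {f : Equiv.Perm (Fin n) → ℝ} (hf : SupportedBelow m f) :
    SupportedBelow m (rep q n hq a f) := by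
  induction ha using Algebra.adjoin_induction generalizing f with
  | mem y hy =>
    obtain ⟨i, hi, rfl⟩ := hy
    by_cases hin : 0 < i ∧ i < n
    · rw [rep_T hq ⟨i, hin⟩]
      exact hf.genOp _ hi
    · intro w hw
      simp [T_eq_zero hin] at hw
  | algebraMap c =>
    intro w hw
    refine hf w fun h => hw ?_
    simp [Algebra.algebraMap_eq_smul_one, h]
  | add x y _ _ hx hy =>
    intro w hw
    by_cases h : rep q n hq x f w = 0
    · exact hy hf w fun h' => hw (by simp [h, h'])
    · exact hx hf w h
  | mul x y _ _ hx hy =>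
    rw [map_mul]
    exact hx (hy hf)

/-- The terms of the coset decomposition send `δ` to functions with disjoint supports, told apart by
the position of the value `m`. Hence each term vanishes separately, and its coset representative
acts injectively, which leaves an element of the smaller parabolic. Only the spanning half of the
decomposition is needed. -/
theorem eq_zero_of_rep_single_eq_zero {m : ℕ} (hm : m ≤ n) {a : HeckeAlgebra K q n}
    (ha : a ∈ parabolic K q n m) (h : rep q n hq a (Pi.single 1 1) = 0) : a = 0 := by
  induction m generalizing a with
  | zero =>
    rw [parabolic_zero, Algebra.mem_bot] at ha
    obtain ⟨c, rfl⟩ := ha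
    have := congrFun h 1
    simp [Algebra.algebraMap_eq_smul_one, Subfield.smul_def] at this
    simp [this]
  | succ m ih =>
    obtain ⟨x, hx, rfl⟩ := exists_eq_sum_ascending_mul ha
    have h1 : SupportedBelow m (Pi.single 1 1 : Equiv.Perm (Fin n) → ℝ) := by
      intro w hw l _
      have : w = 1 := by
        by_contra h
        simp [h] at hw
      simp [this]
    have h2 (d : ℕ) (hd : d ≤ m) :
        SupportedAt m (m - d) (rep q n hq (ascending K q n m d * x d) (Pi.single 1 1)) := by
      rw [map_mul]
      exact supportedAt_ascending hq hm hd (supportedBelow_rep hq (hx d) h1).supportedAt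
    refine Finset.sum_eq_zero fun d hd => ?_
    have hd' : d ≤ m := Nat.lt_succ_iff.mp (Finset.mem_range.mp hd)
    suffices rep q n hq (ascending K q n m d * x d) (Pi.single 1 1) = 0 by
      rw [map_mul] at this
      have := rep_ascending_injective hq hm hd' (this.trans (map_zero _).symm)
      rw [ih (by omega) (hx d) this, mul_zero]
    ext w
    by_contra hw
    have h3 := (h2 d hd' w hw).1 (by omega)
    have h4 := congrFun h w
    rw [map_sum, LinearMap.sum_apply, Finset.sum_apply, Finset.sum_eq_single_of_mem d hd] at h4
    · exact hw h4
    · intro e he hed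
      by_contra hw'
      have he' : e ≤ m := Nat.lt_succ_iff.mp (Finset.mem_range.mp he)
      have h5 := (h2 e he' w hw').1 (by omega)
      have h6 := w.injective (Fin.ext (h3.trans h5.symm))
      rw [Fin.mk.injEq] at h6
      omega

include hq in
theorem eq_zero_of_heckeStar_mul_self_eq_zero (a : HeckeAlgebra K q n) (h : heckeStar a * a = 0) :
    a = 0 := by
  refine eq_zero_of_rep_single_eq_zero hq le_rfl (by rw [parabolic_self]; trivial) ?_
  rw [← dotProduct_self_eq_zero, ← rep_heckeStar, ← Module.End.mul_apply, ← map_mul, h]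
  simp

end Faithful

end Hecke

/-! ### Diagonalizability over `K`, joint eigenvectors, kernels and images -/

namespace Hecke

section Eigenvectors

open Polynomial

variable {K : Type*} [Field K] {q : K} {n : ℕ}

/-- The element `a` acts diagonalizably from the right: its eigenvectors span `H_n`. -/
def IsDiag (a : HeckeAlgebra K q n) : Prop :=
  Submodule.span K {y : HeckeAlgebra K q n | ∃ c : K, y * a = c • y} = ⊤

/-- The monic polynomial with the given multiset of roots. -/
noncomputable def rootPoly (s : Multiset K) : K[X] := (s.map fun c => X - C c).prod

@[simp] theorem rootPoly_zero : rootPoly (0 : Multiset K) = 1 := by simp [rootPoly]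

theorem aeval_rootPoly_cons (a : HeckeAlgebra K q n) (c : K) (s : Multiset K) :
    aeval a (rootPoly (c ::ₘ s)) = (a - c • 1) * aeval a (rootPoly s) := by
  simp [rootPoly, Algebra.algebraMap_eq_smul_one]

theorem rootPoly_add (s t : Multiset K) : rootPoly (s + t) = rootPoly s * rootPoly t := by
  simp [rootPoly]

theorem semiconj_aeval {b x y : HeckeAlgebra K q n} (h : b * x = y * b) (p : K[X]) :
    b * aeval x p = aeval y p * b := by
  induction p using Polynomial.induction_on' with
  | add p r hp hr => simp [mul_add, add_mul, hp, hr]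
  | monomial i c =>
    have : b * x ^ i = y ^ i * b := SemiconjBy.pow_right (show SemiconjBy b x y from h) i
    simp [aeval_monomial, Algebra.algebraMap_eq_smul_one, this]

theorem exists_aeval_rootPoly_eq_zero {S : Set (HeckeAlgebra K q n)}
    (hS : Submodule.span K S = ⊤) {a : HeckeAlgebra K q n}
    (h : ∀ y ∈ S, ∃ s : Multiset K, y * aeval a (rootPoly s) = 0) :
    ∃ s : Multiset K, aeval a (rootPoly s) = 0 := by
  suffices ∀ y ∈ Submodule.span K S, ∃ s : Multiset K, y * aeval a (rootPoly s) = 0 by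
    simpa using this 1 (by simp [hS])
  intro y hy
  induction hy using Submodule.span_induction with
  | mem y hy => exact h y hy
  | zero => exact ⟨0, by simp⟩
  | add x y _ _ hx hy =>
    obtain ⟨s, hs⟩ := hx
    obtain ⟨t, ht⟩ := hy
    refine ⟨s + t, ?_⟩
    rw [add_mul, rootPoly_add, map_mul, ← mul_assoc x, hs, (Commute.all (rootPoly s) _).map
      (aeval a) |>.eq, ← mul_assoc y, ht]
    simp
  | smul c y _ hy =>
    obtain ⟨s, hs⟩ := hy
    exact ⟨s, by rw [smul_mul_assoc, hs, smul_zero]⟩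

theorem IsDiag.exists_aeval_eq_zero {a : HeckeAlgebra K q n} (h : IsDiag a) :
    ∃ s : Multiset K, aeval a (rootPoly s) = 0 := by
  refine exists_aeval_rootPoly_eq_zero h ?_
  rintro y ⟨c, hc⟩
  exact ⟨{c}, by simp [rootPoly, mul_sub, hc, Algebra.algebraMap_eq_smul_one]⟩

theorem isDiag_zero : IsDiag (0 : HeckeAlgebra K q n) :=
  eq_top_iff.mpr fun _ _ => Submodule.subset_span ⟨0, by simp⟩

theorem isDiag_one : IsDiag (1 : HeckeAlgebra K q n) :=
  eq_top_iff.mpr fun _ _ => Submodule.subset_span ⟨1, by simp⟩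

theorem IsDiag.smul {a : HeckeAlgebra K q n} (h : IsDiag a) (c : K) : IsDiag (c • a) := by
  refine eq_top_iff.mpr (h.ge.trans (Submodule.span_mono ?_))
  rintro y ⟨d, hd⟩
  exact ⟨c * d, by rw [mul_smul_comm, hd, smul_smul]⟩

/-- The involution is anisotropic. -/
def Anisotropic (K : Type*) [Field K] (q : K) (n : ℕ) : Prop :=
  ∀ a : HeckeAlgebra K q n, heckeStar a * a = 0 → a = 0

variable (h0 : Anisotropic K q n)

include h0

theorem Anisotropic.mul_eq_zero {y b : HeckeAlgebra K q n} (h : y * (b * heckeStar b) = 0) :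
    y * b = 0 := by
  have : heckeStar (y * b) = 0 := h0 _ (by
    rw [heckeStar_heckeStar, heckeStar_mul, mul_assoc, ← mul_assoc b, ← mul_assoc, h, zero_mul])
  rw [← heckeStar_heckeStar (y * b), this, heckeStar_zero]

theorem Anisotropic.mul_eq_zero_of_sq {y c : HeckeAlgebra K q n} (hc : heckeStar c = c)
    (h : y * c * c = 0) : y * c = 0 :=
  h0.mul_eq_zero (by rw [hc, ← mul_assoc, h])

theorem Anisotropic.mul_eq_zero_of_pow {y c : HeckeAlgebra K q n} (hc : heckeStar c = c) {k : ℕ}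
    (h : y * c ^ k = 0) : y * c = 0 := by
  induction k with
  | zero => simp_all
  | succ k ih =>
    rcases k with _ | k
    · simpa using h
    · refine ih ?_
      rw [pow_succ, ← mul_assoc] at h ⊢
      rw [pow_succ, ← mul_assoc] at h
      exact h0.mul_eq_zero_of_sq hc h

/-- Induction on the roots, which may repeat. If `y (a - c)` is a sum of eigenvectors, those with
eigenvalue other than `c` can be divided by `a - c`; subtracting the quotient `z` leaves `(y - z)(a
- c)² = 0`, and anisotropy removes the square. -/
theorem Anisotropic.isDiag {a : HeckeAlgebra K q n} (ha : heckeStar a = a) {s : Multiset K}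
    (h : aeval a (rootPoly s) = 0) : IsDiag a := by
  set E := {y : HeckeAlgebra K q n | ∃ c : K, y * a = c • y} with hE
  have key (c : K) (w : HeckeAlgebra K q n) (hw : w ∈ Submodule.span K E) :
      ∃ z ∈ Submodule.span K E, (w - z * (a - c • 1)) * (a - c • 1) = 0 := by
    induction hw using Submodule.span_induction with
    | mem w hw =>
      obtain ⟨d, hd⟩ := hw
      by_cases hdc : d = c
      · exact ⟨0, zero_mem _, by simp [mul_sub, hd, hdc]⟩
      · refine ⟨(d - c)⁻¹ • w, Submodule.smul_mem _ _ (Submodule.subset_span ⟨d, hd⟩), ?_⟩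
        have : (d - c)⁻¹ • w * (a - c • 1) = w := by
          rw [smul_mul_assoc, mul_sub, hd, mul_smul_comm, mul_one, ← sub_smul,
            inv_smul_smul₀ (sub_ne_zero.mpr hdc)]
        simp [this]
    | zero => exact ⟨0, zero_mem _, by simp⟩
    | add x y _ _ hx hy =>
      obtain ⟨u, hu, hu'⟩ := hx
      obtain ⟨v, hv, hv'⟩ := hy
      refine ⟨u + v, add_mem hu hv, ?_⟩
      rw [add_mul, add_sub_add_comm, add_mul, hu', hv', add_zero]
    | smul r y _ hy =>
      obtain ⟨u, hu, hu'⟩ := hy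
      refine ⟨r • u, Submodule.smul_mem _ _ hu, ?_⟩
      rw [smul_mul_assoc, ← smul_sub, smul_mul_assoc, hu', smul_zero]
  suffices ∀ s : Multiset K, ∀ y : HeckeAlgebra K q n, y * aeval a (rootPoly s) = 0 →
      y ∈ Submodule.span K E by
    exact eq_top_iff.mpr fun y _ => this s y (by rw [h, mul_zero])
  intro s
  induction s using Multiset.induction with
  | empty =>
    intro y hy
    simp_all
  | cons c s ih =>
    intro y hy
    rw [aeval_rootPoly_cons, ← mul_assoc] at hy
    obtain ⟨z, hz, hz'⟩ := key c _ (ih _ hy)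
    rw [← sub_mul] at hz'
    have h1 := h0.mul_eq_zero_of_sq (by simp [heckeStar_sub, heckeStar_smul, ha]) hz'
    have h2 : y - z ∈ Submodule.span K E := by
      refine Submodule.subset_span ⟨c, ?_⟩
      rwa [mul_sub, mul_smul_comm, mul_one, sub_eq_zero] at h1
    simpa using add_mem h2 hz

/-- Joint generalized eigenspaces span by linear algebra, and anisotropy makes each generalized
eigenvector of a self-adjoint element a genuine one. -/
theorem Anisotropic.span_joint_eigenvectors {ι : Type*} {a : ι → HeckeAlgebra K q n}
    (hs : ∀ i, heckeStar (a i) = a i) (hc : ∀ i j, Commute (a i) (a j))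
    (hd : ∀ i, IsDiag (a i)) :
    Submodule.span K {y : HeckeAlgebra K q n | ∀ i, ∃ c : K, y * a i = c • y} = ⊤ := by
  have h := Module.End.iSup_iInf_maxGenEigenspace_eq_top_of_iSup_maxGenEigenspace_eq_top_of_commute
    (fun i => LinearMap.mulRight K (a i))
    (fun i j _ => by
      refine LinearMap.ext fun y => ?_
      simp [mul_assoc, (hc i j).eq])
    (fun i => by
      refine eq_top_iff.mpr ((hd i).ge.trans (Submodule.span_le.mpr ?_))
      rintro y ⟨c, hc⟩
      refine Submodule.mem_iSup_of_mem c ?_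
      exact (Module.End.mem_maxGenEigenspace _ _ _).mpr ⟨1, by simp [hc]⟩)
  refine eq_top_iff.mpr (h.ge.trans (iSup_le fun χ y hy => Submodule.subset_span fun i => ?_))
  refine ⟨χ i, ?_⟩
  have h1 := (Submodule.mem_iInf _).mp hy i
  obtain ⟨k, hk⟩ := (Module.End.mem_maxGenEigenspace _ _ _).mp h1
  have h2 : LinearMap.mulRight K (a i) - χ i • (1 : Module.End K (HeckeAlgebra K q n)) =
      LinearMap.mulRight K (a i - χ i • 1) := by
    refine LinearMap.ext fun z => ?_
    simp [mul_sub]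
  rw [h2, LinearMap.pow_mulRight, LinearMap.mulRight_apply] at hk
  have h3 := h0.mul_eq_zero_of_pow (by simp [heckeStar_sub, heckeStar_smul, hs i]) hk
  rwa [mul_sub, mul_smul_comm, mul_one, sub_eq_zero] at h3

omit h0 in
-- The affine Hecke intertwiner: `φ` exchanges neighbouring Jucys-Murphy elements, with `x` rescaled
-- by `q`, and its square is a polynomial in them.
theorem intertwiner_aux {A : Type*} [Ring A] [Algebra K A] {t x y : A} {p : K}
    (ht : t * t = (q - 1) • t + q • 1) (hxy : x * y = y * x)
    (h1 : t * y = x * t + ((q - 1) • y + p • 1)) (h2 : y * t = t * x + ((q - 1) • y + p • 1)) :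
    let φ := t * (y - x) - ((q - 1) • y + p • 1)
    φ * y = x * φ ∧ φ * φ = (q • x - y + p • 1) * (q • y - x + p • 1) := by
  have h3 : t * x = y * t - ((q - 1) • y + p • 1) := by rw [h2, add_sub_cancel_right]
  have h1' : ∀ z, t * (y * z) = (x * t + ((q - 1) • y + p • 1)) * z := fun z => by
    rw [← mul_assoc, h1]
  have h3' : ∀ z, t * (x * z) = (y * t - ((q - 1) • y + p • 1)) * z := fun z => by
    rw [← mul_assoc, h3]
  have hyx' : ∀ z, y * (x * z) = x * (y * z) := fun z => by
    rw [← mul_assoc, ← hxy, mul_assoc]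
  constructor <;>
  · simp only [mul_add, add_mul, mul_sub, sub_mul, mul_smul_comm, smul_mul_assoc, mul_one, one_mul,
      smul_add, smul_sub, mul_assoc, h1, h1', h3, h3', ht, ← hxy, hyx']
    module

theorem Anisotropic.isDiag_jucysMurphy (hq : q ≠ 0) (m : ℕ) : IsDiag (jucysMurphy K q n m) := by
  induction m with
  | zero => exact isDiag_zero
  | succ m ih =>
    by_cases hm : 0 < m ∧ m < n
    swap
    · simpa [jucysMurphy, T_eq_zero hm] using isDiag_zero
    have hX := ih.smul q
    have ht := T_mul_self (K := K) (q := q) hm.1 hm.2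
    have hY : jucysMurphy K q n (m + 1) =
      T K q n m * jucysMurphy K q n m * T K q n m + q ^ m • T K q n m := rfl
    have hXY : (q • jucysMurphy K q n m) * jucysMurphy K q n (m + 1) =
        jucysMurphy K q n (m + 1) * (q • jucysMurphy K q n m) :=
      ((commute_jucysMurphy (jucysMurphy_mem_parabolic m)).smul_left q).eq
    have h1 : T K q n m * jucysMurphy K q n (m + 1) = (q • jucysMurphy K q n m) * T K q n m +
        ((q - 1) • jucysMurphy K q n (m + 1) + q ^ (m + 1) • 1) := by
      rw [hY, mul_add, mul_assoc, ← mul_assoc (T K q n m) (T K q n m), ht, mul_smul_comm, ht]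
      simp only [add_mul, smul_mul_assoc, one_mul, pow_succ]
      module
    have h2 : jucysMurphy K q n (m + 1) * T K q n m = T K q n m * (q • jucysMurphy K q n m) +
        ((q - 1) • jucysMurphy K q n (m + 1) + q ^ (m + 1) • 1) := by
      rw [hY, add_mul, mul_assoc, ht, smul_mul_assoc, ht]
      simp only [mul_add, mul_smul_comm, mul_one, mul_assoc, pow_succ]
      module
    suffices ∃ s, aeval (jucysMurphy K q n (m + 1)) (rootPoly s) = 0 from
      h0.isDiag (heckeStar_jucysMurphy _) this.choose_spec
    refine exists_aeval_rootPoly_eq_zero hX ?_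
    rintro v ⟨a, ha⟩
    obtain ⟨s, hs⟩ := hX.exists_aeval_eq_zero
    obtain ⟨h3, h4⟩ := intertwiner_aux ht hXY h1 h2
    have h5 := semiconj_aeval h3 (rootPoly s)
    rw [hs, zero_mul] at h5
    have h6 := congrArg (v * ·) (congrArg (· * aeval (jucysMurphy K q n (m + 1)) (rootPoly s)) h4)
    simp only [mul_assoc _ _ (aeval (jucysMurphy K q n (m + 1)) (rootPoly s)), h5, mul_zero] at h6
    -- If `s` annihilates `x`, then `φ` followed by `s` evaluated at `y` is zero, hence so is `φ²`
    -- followed by it. With `x` acting on `v` as `a`, the two linear factors of `φ²` supply the two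
    -- extra roots.
    refine ⟨(q * a + q ^ (m + 1)) ::ₘ (q⁻¹ * (a - q ^ (m + 1))) ::ₘ s, ?_⟩
    rw [aeval_rootPoly_cons, aeval_rootPoly_cons]
    generalize aeval (jucysMurphy K q n (m + 1)) (rootPoly s) = w at *
    generalize jucysMurphy K q n (m + 1) = y at *
    generalize q • jucysMurphy K q n m = x at *
    have hv : ∀ z, v * (x * z) = a • (v * z) := fun z => by rw [← mul_assoc, ha, smul_mul_assoc]
    have hyx : ∀ z, y * (x * z) = x * (y * z) := fun z => by rw [← mul_assoc, ← hXY, mul_assoc]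
    simp only [mul_add, add_mul, mul_sub, sub_mul, mul_smul_comm, smul_mul_assoc, one_mul,
      smul_add, smul_sub, mul_assoc, hyx, hv, smul_smul] at h6 ⊢
    linear_combination (norm := skip) q⁻¹ • h6
    match_scalars <;> field_simp <;> ring

theorem Anisotropic.isDiag_randomToRandom (hq : q ≠ 0) (hqk : ∀ k, qInt q (k + 1) ≠ 0) {m : ℕ}
    (hm : m ≤ n) (k : ℕ) : IsDiag (randomToRandom K q n m k) := by
  induction m generalizing k with
  | zero =>
    rcases k with _ | k
    · simpa using isDiag_one
    · simpa using isDiag_zero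
  | succ m ih =>
    rcases k with _ | k
    · simpa using isDiag_one
    have hM : IsDiag (recursionElt K q n m k) := by
      have hl := fun j => commute_jucysMurphy
        (randomToRandom_mem_parabolic (K := K) (q := q) (n := n) m j)
      have hr := fun i j => commute_randomToRandom hq hqk (show m ≤ n by omega) i j
      -- `none` indexes the Jucys-Murphy element and `some j` the shuffle `R_{m,j}`; `M` is a
      -- polynomial in these, so it is diagonal on their joint eigenvectors.
      have := h0.span_joint_eigenvectors (ι := Option ℕ)
        (a := fun o => o.elim (jucysMurphy K q n (m + 1)) fun j => randomToRandom K q n m j)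
        (by
          rintro (_ | j)
          · exact heckeStar_jucysMurphy _
          · exact heckeStar_randomToRandom _ _)
        (by
          rintro (_ | i) (_ | j)
          · exact Commute.refl _
          · exact (hl j).symm
          · exact hl i
          · exact hr i j)
        (by
          rintro (_ | j)
          · exact h0.isDiag_jucysMurphy hq _
          · exact ih (by omega) j)
      refine eq_top_iff.mpr (this.ge.trans (Submodule.span_mono fun y hy => ?_))
      obtain ⟨c, hc⟩ := hy none
      obtain ⟨d, hd⟩ := hy (some k)
      obtain ⟨e, he⟩ := hy (some (k + 1))
      simp only [Option.elim] at hc hd he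
      refine ⟨q ^ (k + 1) * e + (qInt q (m + 1 - k) + (q ^ k)⁻¹ * c) * d, ?_⟩
      simp only [recursionElt, mul_add, add_mul, mul_smul_comm, smul_mul_assoc, one_mul,
        ← mul_assoc, hc, hd, he]
      module
    obtain ⟨s, hs⟩ := hM.exists_aeval_eq_zero
    have h1 := semiconj_aeval (B_mul_randomToRandom hq hqk (show m < n by omega) k) (rootPoly s)
    rw [hs, zero_mul] at h1
    -- If `p` annihilates `M`, then `B p(R) = p(M) B = 0`. As `R` ends in the factor `B`, also `R
    -- p(R) = 0`, whence the additional root `0`.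
    refine h0.isDiag (s := 0 ::ₘ s) (heckeStar_randomToRandom _ _) ?_
    rw [aeval_rootPoly_cons, zero_smul, sub_zero]
    conv_lhs => rw [randomToRandom_succ]
    rw [smul_mul_assoc, mul_assoc, mul_assoc, ← randomToRandom_succ, h1]
    simp

theorem Anisotropic.rker_mul_heckeStar (b : HeckeAlgebra K q n) :
    rker (b * heckeStar b) = rker b := by
  ext y
  simp only [rker, LinearMap.mem_ker, LinearMap.mulRight_apply]
  exact ⟨h0.mul_eq_zero, fun h => by rw [← mul_assoc, h, zero_mul]⟩

theorem Anisotropic.rker_heckeStar_mul (b : HeckeAlgebra K q n) :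
    rker (heckeStar b * b) = rker (heckeStar b) := by
  simpa using h0.rker_mul_heckeStar (heckeStar b)

omit h0 in
theorem rim_mul_le (a b : HeckeAlgebra K q n) : rim (a * b) ≤ rim b := by
  rintro _ ⟨y, rfl⟩
  exact ⟨y * a, by simp [mul_assoc]⟩

/-- The kernel equalities give `rank (b* b) = rank b*` and `rank (b b*) = rank b`. Since `rim (b b*)
≤ rim b*`, it follows that `rank b ≤ rank (b* b)`, and the inclusion `rim (b* b) ≤ rim b` is an
equality. -/
theorem Anisotropic.rim_heckeStar_mul (b : HeckeAlgebra K q n) :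
    rim (heckeStar b * b) = rim b := by
  have key (x : HeckeAlgebra K q n) : Module.finrank K (rim x) + Module.finrank K (rker x) =
      Module.finrank K (HeckeAlgebra K q n) :=
    (LinearMap.mulRight K x).finrank_range_add_finrank_ker
  refine Submodule.eq_of_le_of_finrank_le (rim_mul_le _ _) ?_
  have h1 := key (heckeStar b * b)
  have h2 := key (heckeStar b)
  have h3 := key (b * heckeStar b)
  have h4 := key b
  have h5 := Submodule.finrank_mono (rim_mul_le b (heckeStar b))
  rw [h0.rker_heckeStar_mul] at h1
  rw [h0.rker_mul_heckeStar] at h3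
  omega

omit h0 in
theorem rker_smul {c : K} (hc : c ≠ 0) (x : HeckeAlgebra K q n) : rker (c • x) = rker x := by
  ext y
  simp [rker, hc]

omit h0 in
theorem rim_smul {c : K} (hc : c ≠ 0) (x : HeckeAlgebra K q n) : rim (c • x) = rim x := by
  ext y
  constructor
  · rintro ⟨z, rfl⟩
    exact ⟨c • z, by simp⟩
  · rintro ⟨z, rfl⟩
    exact ⟨c⁻¹ • z, by simp [hc]⟩

end Eigenvectors

end Hecke

/-! ### Positivity of `q`-integers and the main theorem -/

namespace Hecke

theorem qInt_succ_ne_zero {K : Subfield ℝ} {q : K} (hq : 0 < (q : ℝ)) (k : ℕ) :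
    qInt q (k + 1) ≠ 0 := by
  have h : 0 < ((qInt q (k + 1) : K) : ℝ) := by
    simp only [qInt, AddSubmonoidClass.coe_finsetSum, SubmonoidClass.coe_pow]
    exact Finset.sum_pos (fun i _ => pow_pos hq i) ⟨0, by simp⟩
  intro h'
  simp [h'] at h

theorem Rk_eq_randomToRandom {K : Type*} [Field K] (q : K) (n k : ℕ) :
    Rk K q n k = randomToRandom K q n n k := rfl

end Hecke

theorem mainTheorem6 (K : Subfield ℝ) (q : K) (hq : 0 < (q : ℝ)) (n : ℕ) :
    (∀ a : Hecke.HeckeAlgebra K q n, Hecke.heckeStar a * a = 0 → a = 0) ∧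
    (∀ k : ℕ, Hecke.rker (Hecke.Rk K q n k) = Hecke.rker (Hecke.BkStar K q n k) ∧
      Hecke.rim (Hecke.Rk K q n k) = Hecke.rim (Hecke.Bk K q n k)) ∧
    (∀ k : ℕ, Hecke.rker (Hecke.Rk K q n k) ≤ Hecke.rker (Hecke.Rk K q n (k + 1))) ∧
    Hecke.rim (Hecke.Rk K q n 0) = ⊤ ∧
    (∀ k : ℕ, Hecke.rim (Hecke.Rk K q n (k + 1)) ≤ Hecke.rim (Hecke.Rk K q n k)) ∧
    (∃ (ι : Type) (b : Module.Basis ι K (Hecke.HeckeAlgebra K q n)), ∀ (k : ℕ) (i : ι),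
      ∃ c : K, Module.End.HasEigenvector (LinearMap.mulRight K (Hecke.Rk K q n k)) c (b i)) := by
  have h0 : Hecke.Anisotropic K q n := Hecke.eq_zero_of_heckeStar_mul_self_eq_zero hq
  have hqk := Hecke.qInt_succ_ne_zero hq
  have hq0 : q ≠ 0 := fun h => by simp [h] at hq
  have hf (k : ℕ) : (Hecke.qFactorial q k)⁻¹ ≠ 0 :=
    inv_ne_zero (Finset.prod_ne_zero_iff.mpr fun i _ => hqk i)
  have hker (k : ℕ) : Hecke.rker (Hecke.Rk K q n k) = Hecke.rker (Hecke.BkStar K q n k) := by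
    rw [Hecke.Rk, Hecke.rker_smul (hf k)]
    exact h0.rker_heckeStar_mul _
  have him (k : ℕ) : Hecke.rim (Hecke.Rk K q n k) = Hecke.rim (Hecke.Bk K q n k) := by
    rw [Hecke.Rk, Hecke.rim_smul (hf k)]
    exact h0.rim_heckeStar_mul _
  have hB (k : ℕ) : Hecke.Bk K q n (k + 1) = Hecke.B K q n (n - k) * Hecke.Bk K q n k :=
    Hecke.bottomToRandom_succ' n k
  refine ⟨h0, fun k => ⟨hker k, him k⟩, fun k => ?_, ?_, fun k => ?_, ?_⟩
  · rw [hker, hker, Hecke.BkStar, Hecke.BkStar, hB, Hecke.heckeStar_mul]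
    intro y hy
    simp only [Hecke.rker, LinearMap.mem_ker, LinearMap.mulRight_apply] at hy ⊢
    rw [← mul_assoc, hy, zero_mul]
  · refine eq_top_iff.mpr fun y _ => ⟨y, ?_⟩
    simp [Hecke.Rk_eq_randomToRandom]
  · rw [him, him, hB]
    exact Hecke.rim_mul_le _ _
  · have hspan := h0.span_joint_eigenvectors (a := Hecke.randomToRandom K q n n)
      (Hecke.heckeStar_randomToRandom n) (Hecke.commute_randomToRandom hq0 hqk le_rfl)
      (h0.isDiag_randomToRandom hq0 hqk le_rfl)
    -- A basis chosen from within the spanning set of joint eigenvectors.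
    let b := Module.Basis.ofSpan hspan.ge
    refine ⟨_, b, fun k i => ?_⟩
    obtain ⟨c, hc⟩ := Module.Basis.ofSpan_subset hspan.ge (Set.mem_range_self i) k
    exact ⟨c, Module.End.mem_eigenspace_iff.mpr hc, b.ne_zero i⟩
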